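/- For $n\ge 1$ let $[n]=\{1,\dots,n\}$, and for a family $\mathcal F$ of subsets of $\mathbf N$ let $\mathcal F_n=\{S\in\mathcal F : S\subseteq [n]\}$, ordered by inclusion. The family $\mathcal F$ is *downward closed* if every subset of a member of $\mathcal F$ is a member of $\mathcal F$. It is *partition-intersecting with $m$ components* if for all $n\ge 2$ the set $M_n$ of maximal elements of $\mathcal F_n$ can be partitioned into $m$ disjoint nonempty classes $M_n=C_1\sqcup\cdots\sqcup C_m$ such that $\bigcap_{S\in C_i}S\neq\emptyset$ for all $i$, and $S\cap T=\emptyset$ for all $i\ne j$, $S\in C_i$ and $T\in C_j$. A *cross-cut* of a finite lattice $L$ with bottom $\widehat 0$ and top $\widehat 1$ is a set $C\subseteq L\setminus\{\widehat 0,\widehat 1\}$ of pairwise incomparable elements such that every maximal chain of $L$ contains an element of $C$. The *cross-cut complex* $\Delta(C)$ is the simplicial complex whose faces are the subsets of $C$ that are not spanning, where a set is *spanning* if its join is $\widehat 1$ and its meet is $\widehat 0$. Let $\widetilde H_k$ denote reduced simplicial homology with coefficients in $\mathbf Z$. **Lemma.** Let $\mathcal F$ be a nonempty downward closed family of subsets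 of $\mathbf N$ that is partition-intersecting with $m$ components, and suppose that $[n]\notin\mathcal F_n$ for all $n\ge 2$. Then for every $n\ge 2$ and every cross-cut $C$ of the lattice $L=\mathcal F_n\cup\{\widehat 1\}$, obtained from $\mathcal F_n$ by adjoining a new top element $\widehat 1$, we have $\widetilde H_0(\Delta(C))\cong\mathbf Z^{m-1}$ and $\widetilde H_k(\Delta(C))=0$ for all $k>0$. -/

import Mathlib

noncomputable section

/-! ### Cross-cuts -/

section CrossCut

variable {L : Type*} [PartialOrder L]

/-- A cross-cut of a lattice `L` with top and bottom elements: a set of pairwise incomparable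
elements, none of them the top or the bottom, that meets every maximal chain of `L`. -/
structure IsCrossCut (C : Set L) : Prop where
  not_isTop : ∀ x ∈ C, ¬ IsTop x
  not_isBot : ∀ x ∈ C, ¬ IsBot x
  isAntichain : IsAntichain (· ≤ ·) C
  meets_maxChain : ∀ c : Set L, IsMaxChain (· ≤ ·) c → (c ∩ C).Nonempty

/-- `S` is spanning if its join is the top element and its meet is the bottom element. -/
def IsSpanning (S : Set L) : Prop :=
  (∃ t, IsTop t ∧ IsLUB S t) ∧ ∃ b, IsBot b ∧ IsGLB S b

theorem IsSpanning.mono {S T : Set L} (hST : S ⊆ T) (hS : IsSpanning S) : IsSpanning T := by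
  obtain ⟨⟨t, ht, hSt⟩, b, hb, hSb⟩ := hS
  exact ⟨⟨t, ht, fun x _ => ht x, fun x hx => hSt.2 (upperBounds_mono_set hST hx)⟩,
    b, hb, fun x _ => hb x, fun x hx => hSb.2 (lowerBounds_mono_set hST hx)⟩

/-- The cross-cut complex `Δ(C)`: the faces are the finite subsets of `C` that are not spanning
(only the nonempty ones are recorded as faces, as usual in Mathlib). -/
def crossCutComplex (C : Set L) : PreAbstractSimplicialComplex L where
  faces := {s | s.Nonempty ∧ (s : Set L) ⊆ C ∧ ¬ IsSpanning (s : Set L)}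
  isRelLowerSet_faces := fun _ hs => ⟨hs.1, fun _ hts ht =>
    ⟨ht, (Finset.coe_subset.2 hts).trans hs.2.1,
      fun h => hs.2.2 (h.mono (Finset.coe_subset.2 hts))⟩⟩

end CrossCut

/-! ### Reduced simplicial homology with integer coefficients

It is computed from the augmented ordered chain complex: the chains of degree `k - 1` are the
formal integer combinations of the ordered `k`-tuples of vertices (repetitions allowed) whose
underlying set is a face. In degree `-1` the only tuple is the empty one, so that the chain group
is `ℤ` and the last boundary map is the augmentation. -/

namespace PreAbstractSimplicialComplex

variable {V : Type*} (K : PreAbstractSimplicialComplex V)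

/-- Ordered simplices with `k` vertices: `k`-tuples whose set of entries is a face of `K`;
for `k = 0` this is just the empty tuple. -/
def OrderedSimplex (k : ℕ) : Type _ :=
  {v : Fin k → V // k = 0 ∨ ∃ s ∈ K.faces, (s : Set V) = Set.range v}

variable {K}

/-- The `i`-th facet of an ordered simplex, obtained by deleting its `i`-th entry. -/
def OrderedSimplex.facet {k : ℕ} (i : Fin (k + 1)) (v : K.OrderedSimplex (k + 1)) :
    K.OrderedSimplex k :=
  ⟨fun j => v.1 (i.succAbove j), by
    classical
    rcases Nat.eq_zero_or_pos k with hk | hk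
    · exact Or.inl hk
    · refine Or.inr ⟨Finset.univ.image fun j => v.1 (i.succAbove j), ?_, by simp⟩
      obtain h | ⟨s, hs, hsv⟩ := v.2
      · omega
      · refine (K.isRelLowerSet_faces hs).2 (fun x hx => ?_) ?_
        · obtain ⟨j, -, rfl⟩ := Finset.mem_image.1 hx
          have : v.1 (i.succAbove j) ∈ (s : Set V) := hsv ▸ Set.mem_range_self _
          exact this
        · exact ⟨_, Finset.mem_image_of_mem _ (Finset.mem_univ (⟨0, hk⟩ : Fin k))⟩⟩

variable (K)

/-- The boundary map `v ↦ ∑ i, (-1) ^ i • (v without its i-th entry)`,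
from chains of degree `k` to chains of degree `k - 1`. -/
def boundary (k : ℕ) : (K.OrderedSimplex (k + 1) →₀ ℤ) →ₗ[ℤ] (K.OrderedSimplex k →₀ ℤ) :=
  ∑ i : Fin (k + 1), (-1 : ℤ) ^ (i : ℕ) • Finsupp.lmapDomain ℤ ℤ (OrderedSimplex.facet i)

theorem OrderedSimplex.facet_facet {k : ℕ} (v : K.OrderedSimplex (k + 2)) (i : Fin (k + 2))
    (j : Fin (k + 1)) :
    OrderedSimplex.facet j (OrderedSimplex.facet i v) =
      OrderedSimplex.facet (j.predAbove i) (OrderedSimplex.facet (i.succAbove j) v) := by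
  apply Subtype.ext
  funext x
  simp only [OrderedSimplex.facet]
  rw [Fin.succAbove_succAbove_succAbove_predAbove]

/-- Boundaries are cycles. -/
theorem boundary_boundary (k : ℕ) (x : K.OrderedSimplex (k + 2) →₀ ℤ) :
    K.boundary k (K.boundary (k + 1) x) = 0 := by
  classical
  suffices h : K.boundary k ∘ₗ K.boundary (k + 1) = 0 from LinearMap.congr_fun h x
  ext v : 2
  simp only [boundary, LinearMap.comp_apply, LinearMap.sum_apply, LinearMap.smul_apply,
    Finsupp.lsingle_apply, Finsupp.lmapDomain_apply, Finsupp.mapDomain_single, map_sum, map_smul,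
    LinearMap.zero_apply, Finset.smul_sum, smul_smul]
  rw [← Finset.sum_product']
  refine Finset.sum_involution (fun p _ => (p.1.succAbove p.2, p.2.predAbove p.1)) ?_ ?_ ?_ ?_
  · rintro ⟨i, j⟩ -
    dsimp only
    rw [OrderedSimplex.facet_facet, ← pow_add, ← pow_add, Fin.neg_one_pow_succAbove_add_predAbove]
    simp
  · rintro ⟨i, j⟩ - - h
    exact Fin.succAbove_ne i j (congrArg Prod.fst h)
  · simp
  · rintro ⟨i, j⟩ -
    exact Prod.ext (Fin.succAbove_succAbove_predAbove i j) (Fin.predAbove_predAbove_succAbove i j)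

/-- The reduced homology group `H̃ₖ(K; ℤ)`: cycles of degree `k` modulo boundaries. -/
abbrev reducedHomology (k : ℕ) : Type _ :=
  LinearMap.ker (K.boundary k) ⧸
    (LinearMap.range (K.boundary (k + 1))).submoduleOf (LinearMap.ker (K.boundary k))

end PreAbstractSimplicialComplex

/-! ### Set families -/

/-- `𝓕ₙ = 𝓕 ∩ 2^[n]`, the members of the family contained in `[n] = {1, …, n}`. -/
def familyRestrict (F : Set (Set ℕ)) (n : ℕ) : Set (Set ℕ) :=
  {S | S ∈ F ∧ S ⊆ Set.Icc 1 n}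

/-- The poset `𝓕ₙ ∪ {1̂}`: the members of `𝓕ₙ` ordered by inclusion, together with a new top
element. It is a lattice if `𝓕` is nonempty and downward closed. -/
abbrev familyLattice (F : Set (Set ℕ)) (n : ℕ) : Type :=
  WithTop (familyRestrict F n)

/-- `F` is partition-intersecting with `m` components: for every `n ≥ 2` the set of maximal elements
of `𝓕ₙ` splits into `m` nonempty disjoint classes such that the members of each class have a common
element and members of different classes are disjoint. -/
def IsPartitionIntersecting (F : Set (Set ℕ)) (m : ℕ) : Prop :=
  ∀ n : ℕ, 2 ≤ n → ∃ c : Fin m → Set (Set ℕ),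
    (∀ i, (c i).Nonempty) ∧
    (∀ i j, i ≠ j → Disjoint (c i) (c j)) ∧
    (⋃ i, c i) = {S | Maximal (· ∈ familyRestrict F n) S} ∧
    (∀ i, (⋂₀ c i).Nonempty) ∧
    (∀ i j, i ≠ j → ∀ S ∈ c i, ∀ T ∈ c j, S ∩ T = ∅)

end

/-! Split the nonempty members of `𝓕ₙ` into components, one for each class `c i`: those contained in
a member of `c i`. The components are disjoint because members of different classes do not meet. A
nonempty subset of `C` fails to span exactly when it has an upper bound in `𝓕ₙ` or a nonempty lower
bound; either bound forces the subset into a single component. So `Δ(C)` is a disjoint union of `m`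
complexes of bounded subsets of an antichain, and it is enough that each of them is acyclic: `m`
acyclic pieces have reduced `H₀` of rank `m - 1` and nothing above (`IsDisjointUnion`).

Acyclicity is carried along two comparisons. The full simplex on the members of `c i` is compared
with the order complex of the component (`acyclic_orderComplex`), where the common element of `c i`
makes all meets of members of `c i` nonempty. The order complex is then compared with the bounded
complex (`acyclic_boundedComplex`), which is the cross-cut theorem. Both comparisons use a relation
`D` between two complexes whose fibres over nonempty sets are cones; the double complex of pairs of
tuples in `D` transfers acyclicity (`acyclic_tuples_of_cones`). -/

noncomputable section

universe u v

/-! ### Augmented semisimplicial sets -/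

/-- An augmented semisimplicial set; `obj k` is the set of simplices with `k` vertices. -/
structure AugSemisimplicialSet where
  obj : ℕ → Type u
  facet : ∀ {k : ℕ}, Fin (k + 1) → obj (k + 1) → obj k
  facet_facet : ∀ {k : ℕ} (v : obj (k + 2)) (i : Fin (k + 2)) (j : Fin (k + 1)),
    facet j (facet i v) = facet (j.predAbove i) (facet (i.succAbove j) v)

namespace AugSemisimplicialSet

variable (T : AugSemisimplicialSet.{u}) {T' : AugSemisimplicialSet.{v}}

/-- The alternating sum of the facet maps. -/
def boundary (k : ℕ) : (T.obj (k + 1) →₀ ℤ) →ₗ[ℤ] (T.obj k →₀ ℤ) :=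
  ∑ i : Fin (k + 1), (-1 : ℤ) ^ (i : ℕ) • Finsupp.lmapDomain ℤ ℤ (T.facet i)

theorem boundary_single (k : ℕ) (v : T.obj (k + 1)) (c : ℤ) :
    T.boundary k (Finsupp.single v c) =
      ∑ i : Fin (k + 1), (-1 : ℤ) ^ (i : ℕ) • Finsupp.single (T.facet i v) c := by
  simp only [boundary, LinearMap.sum_apply, LinearMap.smul_apply, Finsupp.lmapDomain_apply,
    Finsupp.mapDomain_single]

theorem boundary_boundary (k : ℕ) (x : T.obj (k + 2) →₀ ℤ) :
    T.boundary k (T.boundary (k + 1) x) = 0 := by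
  classical
  suffices h : T.boundary k ∘ₗ T.boundary (k + 1) = 0 from LinearMap.congr_fun h x
  ext v : 2
  simp only [LinearMap.comp_apply, Finsupp.lsingle_apply, boundary_single, map_sum, map_smul,
    LinearMap.zero_apply, Finset.smul_sum, smul_smul]
  rw [← Finset.sum_product']
  refine Finset.sum_involution (fun p _ => (p.1.succAbove p.2, p.2.predAbove p.1)) ?_ ?_ ?_ ?_
  · rintro ⟨i, j⟩ -
    dsimp only
    rw [T.facet_facet, ← pow_add, ← pow_add, Fin.neg_one_pow_succAbove_add_predAbove]
    simp
  · rintro ⟨i, j⟩ - - h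
    exact Fin.succAbove_ne i j (congrArg Prod.fst h)
  · simp
  · rintro ⟨i, j⟩ -
    exact Prod.ext (Fin.succAbove_succAbove_predAbove i j) (Fin.predAbove_predAbove_succAbove i j)

/-- The augmented chain complex is exact. -/
def Acyclic : Prop :=
  (∀ z, ∃ y, T.boundary 0 y = z) ∧
    ∀ k z, T.boundary k z = 0 → ∃ y, T.boundary (k + 1) y = z

variable {T}

/-- The map induced by `s` is a contracting homotopy: facet `0` contributes the identity, and the
other facets contribute `-s ∘ ∂`. -/
theorem acyclic_of_extraDegeneracy (s : ∀ k, T.obj k → T.obj (k + 1))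
    (h0 : ∀ k v, T.facet 0 (s k v) = v)
    (hs : ∀ k (i : Fin (k + 1)) v, T.facet i.succ (s (k + 1) v) = s k (T.facet i v)) :
    T.Acyclic := by
  have hzero : T.boundary 0 ∘ₗ Finsupp.lmapDomain ℤ ℤ (s 0) = LinearMap.id := by
    ext v : 2
    simp [boundary_single, h0]
  have hsucc (k : ℕ) : T.boundary (k + 1) ∘ₗ Finsupp.lmapDomain ℤ ℤ (s (k + 1)) =
      LinearMap.id - Finsupp.lmapDomain ℤ ℤ (s k) ∘ₗ T.boundary k := by
    ext v : 2
    simp only [LinearMap.comp_apply, Finsupp.lsingle_apply, Finsupp.lmapDomain_apply,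
      Finsupp.mapDomain_single, boundary_single, LinearMap.sub_apply, LinearMap.id_apply]
    rw [Fin.sum_univ_succ, ← Finsupp.lmapDomain_apply ℤ ℤ, map_sum]
    simp [h0, hs, pow_succ, sub_eq_add_neg]
  refine ⟨fun z => ⟨_, LinearMap.congr_fun hzero z⟩, fun k z hz =>
    ⟨Finsupp.lmapDomain ℤ ℤ (s (k + 1)) z, ?_⟩⟩
  simpa [hz] using LinearMap.congr_fun (hsucc k) z

theorem boundary_mapDomain (f : ∀ k, T.obj k → T'.obj k)
    (hf : ∀ k (i : Fin (k + 1)) v, f k (T.facet i v) = T'.facet i (f (k + 1) v))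
    (k : ℕ) (z : T.obj (k + 1) →₀ ℤ) :
    T'.boundary k (Finsupp.lmapDomain ℤ ℤ (f (k + 1)) z) =
      Finsupp.lmapDomain ℤ ℤ (f k) (T.boundary k z) := by
  suffices h : T'.boundary k ∘ₗ Finsupp.lmapDomain ℤ ℤ (f (k + 1)) =
      Finsupp.lmapDomain ℤ ℤ (f k) ∘ₗ T.boundary k from LinearMap.congr_fun h z
  ext v : 2
  simp only [LinearMap.comp_apply, Finsupp.lsingle_apply, Finsupp.lmapDomain_apply,
    Finsupp.mapDomain_single, boundary_single]
  rw [← Finsupp.lmapDomain_apply ℤ ℤ, map_sum]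
  simp [hf]

theorem Acyclic.of_equiv (hT : T.Acyclic) (e : ∀ k, T.obj k ≃ T'.obj k)
    (he : ∀ k (i : Fin (k + 1)) v, e k (T.facet i v) = T'.facet i (e (k + 1) v)) :
    T'.Acyclic := by
  have he' (k) (i : Fin (k + 1)) (v) :
      (e k).symm (T'.facet i v) = T.facet i ((e (k + 1)).symm v) := by
    rw [Equiv.symm_apply_eq, he, Equiv.apply_symm_apply]
  have hinv (k : ℕ) (z : T'.obj k →₀ ℤ) :
      Finsupp.lmapDomain ℤ ℤ (e k) (Finsupp.lmapDomain ℤ ℤ (e k).symm z) = z := by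
    simp [← Finsupp.mapDomain_comp]
  have hmap := boundary_mapDomain (fun k => e k) he
  have hmap' := boundary_mapDomain (fun k => (e k).symm) he'
  refine ⟨fun z => ?_, fun k z hz => ?_⟩
  · obtain ⟨y, hy⟩ := hT.1 (Finsupp.lmapDomain ℤ ℤ (e 0).symm z)
    exact ⟨Finsupp.lmapDomain ℤ ℤ (e 1) y, by rw [hmap 0, hy, hinv]⟩
  · obtain ⟨y, hy⟩ := hT.2 k (Finsupp.lmapDomain ℤ ℤ (e (k + 1)).symm z) (by
      rw [hmap' k, hz, map_zero])
    exact ⟨Finsupp.lmapDomain ℤ ℤ (e (k + 2)) y, by rw [hmap (k + 1), hy, hinv]⟩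

end AugSemisimplicialSet

/-- In a double complex with exact rows whose columns of positive index are exact, the column of
index zero is exact. -/
theorem exact_column_zero_of_exact {A : ℕ → ℕ → Type*} [∀ p q, AddCommGroup (A p q)]
    (d : ∀ p q, A (p + 1) q →+ A p q) (e : ∀ p q, A p (q + 1) →+ A p q)
    (hde : ∀ p q x, d p q (e (p + 1) q x) = e p q (d p (q + 1) x))
    (hd : ∀ p q x, d p q (d (p + 1) q x) = 0) (he : ∀ p q x, e p q (e p (q + 1) x) = 0)
    (hrow_zero : ∀ q z, ∃ y, d 0 q y = z)
    (hrow : ∀ p q z, d p q z = 0 → ∃ y, d (p + 1) q y = z)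
    (hcol_zero : ∀ p z, ∃ y, e (p + 1) 0 y = z)
    (hcol : ∀ p q z, e (p + 1) q z = 0 → ∃ y, e (p + 1) (q + 1) y = z) :
    (∀ z, ∃ y, e 0 0 y = z) ∧ ∀ q z, e 0 q z = 0 → ∃ y, e 0 (q + 1) y = z := by
  -- Staircase argument: lift `e z` along `d` to some `y`, decompose `y` one step down the diagonal
  -- (or by `hcol_zero` at the bottom) as `e w + d u`, and correct `z` by `d w` to get a vertical
  -- cycle.
  have key (q : ℕ) : ∀ p (z : A (p + 1) (q + 1)), d p q (e (p + 1) q z) = 0 →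
      ∃ w u, z = e (p + 1) (q + 1) w + d (p + 1) (q + 1) u := by
    induction q with
    | zero =>
      intro p z hz
      obtain ⟨y, hy⟩ := hrow p 0 _ hz
      obtain ⟨w, rfl⟩ := hcol_zero (p + 1) y
      obtain ⟨w', hw'⟩ := hcol p 0 (z - d (p + 1) 1 w) (by
        rw [map_sub, ← hde, hy, sub_self])
      exact ⟨w', w, by rw [hw', sub_add_cancel]⟩
    | succ q ih =>
      intro p z hz
      obtain ⟨y, hy⟩ := hrow p (q + 1) _ hz
      obtain ⟨w, u, rfl⟩ := ih (p + 1) y (by rw [hde, hy, he])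
      rw [map_add, hd, add_zero, hde] at hy
      obtain ⟨w', hw'⟩ := hcol p (q + 1) (z - d (p + 1) (q + 2) w) (by
        rw [map_sub, hy, sub_self])
      exact ⟨w', w, by rw [hw', sub_add_cancel]⟩
  refine ⟨fun z => ?_, fun q z hz => ?_⟩
  · obtain ⟨y, rfl⟩ := hrow_zero 0 z
    obtain ⟨w, rfl⟩ := hcol_zero 0 y
    exact ⟨d 0 1 w, (hde _ _ _).symm⟩
  · obtain ⟨y, rfl⟩ := hrow_zero (q + 1) z
    obtain ⟨w, u, rfl⟩ := key q 0 y (by rw [hde, hz])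
    exact ⟨d 0 (q + 2) w, by rw [map_add, hd, add_zero, hde]⟩

/-! ### Tuples spanning a face -/

namespace LowerSet

open AugSemisimplicialSet

variable {V : Type u} {W : Type v}

theorem range_comp_succAbove_subset {k : ℕ} (i : Fin (k + 1)) (v : Fin (k + 1) → V) :
    (Set.range fun j => v (i.succAbove j)) ⊆ Set.range v :=
  Set.range_comp_subset_range i.succAbove v

/-- The tuples whose set of entries belongs to `K`. -/
def tuples (K : LowerSet (Set V)) : AugSemisimplicialSet.{u} where
  obj k := {v : Fin k → V // Set.range v ∈ K}
  facet i v := ⟨fun j => v.1 (i.succAbove j), K.lower (range_comp_succAbove_subset i v.1) v.2⟩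
  facet_facet v i j := by
    apply Subtype.ext
    funext x
    dsimp only
    rw [Fin.succAbove_succAbove_succAbove_predAbove]

theorem acyclic_tuples_of_cone (K : LowerSet (Set V)) (x : V) (hx : ∀ s ∈ K, insert x s ∈ K) :
    K.tuples.Acyclic := by
  refine acyclic_of_extraDegeneracy
    (fun k v => ⟨Fin.cons x v.1, by rw [Fin.range_cons]; exact hx _ v.2⟩) ?_ ?_
  · intro k v
    apply Subtype.ext
    funext j
    simp [tuples]
  · intro k i v
    apply Subtype.ext
    funext j
    refine Fin.cases ?_ (fun j => ?_) j <;> simp [tuples]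

theorem mem_prod_of_subset (D : LowerSet (Set V × Set W)) {s s' : Set V} {t t' : Set W}
    (hs : s ⊆ s') (ht : t ⊆ t') (h : (s', t') ∈ D) : (s, t) ∈ D :=
  D.lower (Prod.mk_le_mk.2 ⟨hs, ht⟩) h

/-- Pairs of tuples in `D`, as an augmented semisimplicial set in the first tuple. -/
abbrev rows (D : LowerSet (Set V × Set W)) (q : ℕ) : AugSemisimplicialSet.{max u v} where
  obj p := {x : (Fin p → V) × (Fin q → W) // (Set.range x.1, Set.range x.2) ∈ D}
  facet i x := ⟨(fun j => x.1.1 (i.succAbove j), x.1.2),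
    D.mem_prod_of_subset (range_comp_succAbove_subset i x.1.1) subset_rfl x.2⟩
  facet_facet v i j := by
    apply Subtype.ext
    refine Prod.ext (funext fun x => ?_) rfl
    dsimp only
    rw [Fin.succAbove_succAbove_succAbove_predAbove]

/-- Pairs of tuples in `D`, as an augmented semisimplicial set in the second tuple. -/
abbrev columns (D : LowerSet (Set V × Set W)) (p : ℕ) : AugSemisimplicialSet.{max u v} where
  obj q := {x : (Fin p → V) × (Fin q → W) // (Set.range x.1, Set.range x.2) ∈ D}
  facet i x := ⟨(x.1.1, fun j => x.1.2 (i.succAbove j)),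
    D.mem_prod_of_subset subset_rfl (range_comp_succAbove_subset i x.1.2) x.2⟩
  facet_facet v i j := by
    apply Subtype.ext
    refine Prod.ext rfl (funext fun x => ?_)
    dsimp only
    rw [Fin.succAbove_succAbove_succAbove_predAbove]

theorem rows_boundary_columns_boundary (D : LowerSet (Set V × Set W)) (p q : ℕ)
    (x : (D.columns (p + 1)).obj (q + 1) →₀ ℤ) :
    (D.rows q).boundary p ((D.columns (p + 1)).boundary q x) =
      (D.columns p).boundary q ((D.rows (q + 1)).boundary p x) := by
  suffices h : (D.rows q).boundary p ∘ₗ (D.columns (p + 1)).boundary q =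
      (D.columns p).boundary q ∘ₗ (D.rows (q + 1)).boundary p from LinearMap.congr_fun h x
  refine Finsupp.lhom_ext fun a b => ?_
  refine (congrArg ((D.rows q).boundary p) ((D.columns (p + 1)).boundary_single q a b)).trans ?_
  refine Eq.trans ?_
    (congrArg ((D.columns p).boundary q) ((D.rows (q + 1)).boundary_single p a b)).symm
  have h1 (i) : (D.rows q).boundary p (Finsupp.single ((D.columns (p + 1)).facet i a) b) = _ :=
    (D.rows q).boundary_single p _ b
  have h2 (i) : (D.columns p).boundary q (Finsupp.single ((D.rows (q + 1)).facet i a) b) = _ :=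
    (D.columns p).boundary_single q _ b
  rw [map_sum, map_sum]
  simp only [map_smul, h1, h2, Finset.smul_sum]
  rw [Finset.sum_comm]
  exact Finset.sum_congr rfl fun i _ => Finset.sum_congr rfl fun j _ => smul_comm _ _ _

/-- The apex depends only on the second tuple, which the facets of a row leave fixed, so prepending
it is an extra degeneracy. The index `q + 1` makes the second tuple nonempty. -/
theorem acyclic_rows (D : LowerSet (Set V × Set W)) (q : ℕ)
    (h : ∀ t : Set W, t.Nonempty → (∅, t) ∈ D → ∃ x : V, ∀ s, (s, t) ∈ D → (insert x s, t) ∈ D) :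
    (D.rows (q + 1)).Acyclic := by
  have h' (w : Fin (q + 1) → W) (hw : (∅, Set.range w) ∈ D) :=
    h (Set.range w) (Set.range_nonempty w) hw
  choose x hx using h'
  have hD {p : ℕ} (y : (D.rows (q + 1)).obj p) : ((∅ : Set V), Set.range y.1.2) ∈ D :=
    D.mem_prod_of_subset (Set.empty_subset _) subset_rfl y.2
  refine acyclic_of_extraDegeneracy
    (fun k v => ⟨(Fin.cons (x v.1.2 (hD v)) v.1.1, v.1.2), by
      dsimp only
      rw [Fin.range_cons]
      exact hx _ _ _ v.2⟩) ?_ ?_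
  · intro k v
    apply Subtype.ext
    refine Prod.ext (funext fun j => ?_) rfl
    simp
  · intro k i v
    apply Subtype.ext
    refine Prod.ext (funext fun j => ?_) rfl
    refine Fin.cases ?_ (fun j => ?_) j <;> simp

theorem acyclic_columns (D : LowerSet (Set V × Set W)) (p : ℕ)
    (h : ∀ s : Set V, s.Nonempty → (s, ∅) ∈ D → ∃ y : W, ∀ t, (s, t) ∈ D → (s, insert y t) ∈ D) :
    (D.columns (p + 1)).Acyclic := by
  have h' (w : Fin (p + 1) → V) (hw : (Set.range w, ∅) ∈ D) :=
    h (Set.range w) (Set.range_nonempty w) hw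
  choose x hx using h'
  have hD {q : ℕ} (y : (D.columns (p + 1)).obj q) : (Set.range y.1.1, (∅ : Set W)) ∈ D :=
    D.mem_prod_of_subset subset_rfl (Set.empty_subset _) y.2
  refine acyclic_of_extraDegeneracy
    (fun k v => ⟨(v.1.1, Fin.cons (x v.1.1 (hD v)) v.1.2), by
      dsimp only
      rw [Fin.range_cons]
      exact hx _ _ _ v.2⟩) ?_ ?_
  · intro k v
    apply Subtype.ext
    refine Prod.ext rfl (funext fun j => ?_)
    simp
  · intro k i v
    apply Subtype.ext
    refine Prod.ext rfl (funext fun j => ?_)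
    refine Fin.cases ?_ (fun j => ?_) j <;> simp

/-- If the fibres of `D` over nonempty sets on either side are cones and the fibre over the empty
set on the right is acyclic, then so is the fibre over the empty set on the left. -/
theorem acyclic_tuples_of_cones (D : LowerSet (Set V × Set W))
    (hrow : ∀ t : Set W, t.Nonempty → (∅, t) ∈ D →
      ∃ x : V, ∀ s, (s, t) ∈ D → (insert x s, t) ∈ D)
    (hcol : ∀ s : Set V, s.Nonempty → (s, ∅) ∈ D →
      ∃ y : W, ∀ t, (s, t) ∈ D → (s, insert y t) ∈ D)
    {K : LowerSet (Set V)} {K' : LowerSet (Set W)}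
    (hK : ∀ s, s ∈ K ↔ (s, ∅) ∈ D) (hK' : ∀ t, t ∈ K' ↔ (∅, t) ∈ D)
    (h : K.tuples.Acyclic) : K'.tuples.Acyclic := by
  have hzero : (D.rows 0).Acyclic := by
    refine h.of_equiv (fun k => ?_) ?_
    · exact
      { toFun v := ⟨(v.1, Fin.elim0), by
          have := (hK _).1 v.2
          rwa [← Set.range_eq_empty (Fin.elim0 : Fin 0 → W)] at this⟩
        invFun x := ⟨x.1.1, by
          have := x.2
          rw [Set.range_eq_empty x.1.2] at this
          exact (hK _).2 this⟩
        left_inv v := rfl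
        right_inv x := Subtype.ext (Prod.ext rfl (Subsingleton.elim _ _)) }
    · intro k i v
      rfl
  have hrows (q : ℕ) : (D.rows q).Acyclic := by
    cases q with
    | zero => exact hzero
    | succ q => exact D.acyclic_rows q hrow
  have hcols (p : ℕ) := D.acyclic_columns p hcol
  -- Row `0` is the complex of `K` and column `0` is that of `K'`, the other tuple being empty
  -- there.
  have hmain : (D.columns 0).Acyclic :=
    exact_column_zero_of_exact
      (A := fun p q => {x : (Fin p → V) × (Fin q → W) // (Set.range x.1, Set.range x.2) ∈ D} →₀ ℤ)
      (fun p q => ((D.rows q).boundary p).toAddMonoidHom)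
      (fun p q => ((D.columns p).boundary q).toAddMonoidHom)
      (D.rows_boundary_columns_boundary)
      (fun p q => (D.rows q).boundary_boundary p) (fun p q => (D.columns p).boundary_boundary q)
      (fun q => (hrows q).1) (fun p q => (hrows q).2 p) (fun p => (hcols p).1)
      (fun p q => (hcols p).2 q)
  refine hmain.of_equiv (fun k => ?_) ?_
  · exact
    { toFun x := ⟨x.1.2, by
        have := x.2
        rw [Set.range_eq_empty x.1.1] at this
        exact (hK' _).2 this⟩
      invFun v := ⟨(Fin.elim0, v.1), by
        have := (hK' _).1 v.2
        rwa [← Set.range_eq_empty (Fin.elim0 : Fin 0 → V)] at this⟩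
      left_inv x := Subtype.ext (Prod.ext (Subsingleton.elim _ _) rfl)
      right_inv v := rfl }
  · intro k i v
    rfl

end LowerSet

/-! ### The order complex and the cross-cut complex of a poset -/

section Poset

variable {P : Type u} [PartialOrder P]

/-- The order complex: sets of pairwise comparable elements. -/
def orderComplex (P : Type u) [PartialOrder P] : LowerSet (Set P) where
  carrier := {s | IsChain (· ≤ ·) s}
  lower' _ _ hts hs := IsChain.mono hts hs

/-- The subsets of `X` that are bounded above or below. -/
def boundedComplex (X : Set P) : LowerSet (Set P) where
  carrier := {t | t ⊆ X ∧ (BddAbove t ∨ BddBelow t)}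
  lower' _ _ hts ht := ⟨subset_trans hts ht.1, ht.2.imp (·.mono hts) (·.mono hts)⟩

/-- Relate a subset of `M` to the chains lying below all its elements. The fibre over a chain is a
cone on an upper bound in `M`, the fibre over a subset of `M` is a cone on its meet, and the full
simplex on `M` is acyclic. -/
theorem acyclic_orderComplex {M : Set P} (hM : M.Nonempty) (hbdd : BddBelow M)
    (hinf : ∀ t : Set P, t.Nonempty → BddBelow t → ∃ b, IsGLB t b)
    (hchain : ∀ s : Set P, s.Nonempty → IsChain (· ≤ ·) s → ∃ x ∈ M, x ∈ upperBounds s) :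
    (orderComplex P).tuples.Acyclic := by
  let K : LowerSet (Set P) := ⟨{t | t ⊆ M}, fun _ _ hts ht => subset_trans hts ht⟩
  let D : LowerSet (Set P × Set P) :=
    { carrier := {x | x.1 ⊆ M ∧ IsChain (· ≤ ·) x.2 ∧ ∀ t ∈ x.1, t ∈ upperBounds x.2}
      lower' := fun a b hab ha => ⟨subset_trans hab.1 ha.1, ha.2.1.mono hab.2,
        fun t ht => upperBounds_mono_set hab.2 (ha.2.2 t (hab.1 ht))⟩ }
  obtain ⟨x, hx⟩ := hM
  have hK : K.tuples.Acyclic :=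
    K.acyclic_tuples_of_cone x fun s hs => Set.insert_subset hx hs
  refine D.acyclic_tuples_of_cones ?_ ?_ (K := K) ?_ ?_ hK
  · rintro s hs ⟨-, hs', -⟩
    obtain ⟨y, hyM, hy⟩ := hchain s hs hs'
    refine ⟨y, fun t ht => ⟨Set.insert_subset hyM ht.1, ht.2.1, ?_⟩⟩
    rintro z (rfl | hz)
    · exact hy
    · exact ht.2.2 z hz
  · rintro t ht ⟨htM, -, -⟩
    obtain ⟨b, hb⟩ := hinf t ht (hbdd.mono htM)
    refine ⟨b, fun s hs => ⟨htM, ?_, ?_⟩⟩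
    · refine hs.2.1.insert fun y hy _ => Or.inr ?_
      exact hb.2 fun z hz => hs.2.2 z hz hy
    · rintro z hz y (rfl | hy)
      · exact hb.1 hz
      · exact hs.2.2 z hz hy
  · intro s
    refine ⟨fun hs => ⟨hs, IsChain.empty, by simp⟩, fun hs => hs.1⟩
  · intro s
    refine ⟨fun hs => ⟨Set.empty_subset _, hs, by simp⟩, fun hs => hs.2.1⟩

theorem IsAntichain.subset_Iic_or_subset_Ici {t : Set P} (ht : IsAntichain (· ≤ ·) t) {s : P}
    (hs : ∀ x ∈ t, x ≤ s ∨ s ≤ x) : t ⊆ Set.Iic s ∨ t ⊆ Set.Ici s := by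
  by_contra! h
  obtain ⟨h1, h2⟩ := h
  obtain ⟨x, hx, hxs⟩ := Set.not_subset.1 h1
  obtain ⟨y, hy, hys⟩ := Set.not_subset.1 h2
  have hsx := (hs x hx).resolve_left hxs
  have hys' := (hs y hy).resolve_right hys
  exact hxs ((ht.eq hy hx (hys'.trans hsx)) ▸ hys')

/-- Relate a chain to a bounded subset of `X` when all their elements are mutually comparable. The
apex is a join or meet over a bounded set, and an element of `X` comparable with the whole chain
over a chain. -/
theorem acyclic_boundedComplex {X : Set P} (hX : IsAntichain (· ≤ ·) X)
    (hsup : ∀ t : Set P, t.Nonempty → BddAbove t → ∃ b, IsLUB t b)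
    (hinf : ∀ t : Set P, t.Nonempty → BddBelow t → ∃ b, IsGLB t b)
    (hchain : ∀ s : Set P, s.Nonempty → IsChain (· ≤ ·) s →
      ∃ x ∈ X, ∀ y ∈ s, x ≤ y ∨ y ≤ x)
    (hP : (orderComplex P).tuples.Acyclic) :
    (boundedComplex X).tuples.Acyclic := by
  -- In an empty poset the empty set is not bounded, but there `hP` fails already at the
  -- augmentation.
  by_cases hne : Nonempty P
  swap
  · obtain ⟨y, hy⟩ := hP.1 (Finsupp.single
      ⟨Fin.elim0, fun x => (hne ⟨x⟩).elim⟩ 1)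
    have : y = 0 := by
      ext v
      exact (hne ⟨v.1 0⟩).elim
    rw [this, map_zero] at hy
    exact absurd hy.symm (Finsupp.single_ne_zero.2 one_ne_zero)
  let D : LowerSet (Set P × Set P) :=
    { carrier := {x | IsChain (· ≤ ·) x.1 ∧ x.2 ∈ boundedComplex X ∧
        ∀ s ∈ x.1, ∀ t ∈ x.2, t ≤ s ∨ s ≤ t}
      lower' := fun a b hab ha => ⟨ha.1.mono hab.1, (boundedComplex X).lower hab.2 ha.2.1,
        fun s hs t ht => ha.2.2 s (hab.1 hs) t (hab.2 ht)⟩ }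
  refine D.acyclic_tuples_of_cones ?_ ?_ (K := orderComplex P) ?_ ?_ hP
  · rintro t ht ⟨-, ⟨htX, htb⟩, -⟩
    -- The join (or meet) of `t` is comparable with everything that is comparable with all of `t`,
    -- so it extends every chain in the fibre.
    obtain ⟨b, hbt, hb⟩ : ∃ b, (∀ x ∈ t, x ≤ b ∨ b ≤ x) ∧
        ∀ s, (∀ x ∈ t, x ≤ s ∨ s ≤ x) → b ≤ s ∨ s ≤ b := by
      rcases htb with htb | htb
      · obtain ⟨b, hb⟩ := hsup t ht htb
        refine ⟨b, fun x hx => Or.inl (hb.1 hx), fun s hs => ?_⟩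
        by_cases h : ∃ x ∈ t, s ≤ x
        · obtain ⟨x, hx, hsx⟩ := h
          exact Or.inr (hsx.trans (hb.1 hx))
        · push Not at h
          exact Or.inl (hb.2 fun x hx => (hs x hx).resolve_right (h x hx))
      · obtain ⟨b, hb⟩ := hinf t ht htb
        refine ⟨b, fun x hx => Or.inr (hb.1 hx), fun s hs => ?_⟩
        by_cases h : ∃ x ∈ t, x ≤ s
        · obtain ⟨x, hx, hsx⟩ := h
          exact Or.inl ((hb.1 hx).trans hsx)
        · push Not at h
          exact Or.inr (hb.2 fun x hx => (hs x hx).resolve_left (h x hx))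
    refine ⟨b, fun s hs => ⟨hs.1.insert fun y hy _ => hb y (hs.2.2 y hy), ⟨htX, htb⟩, ?_⟩⟩
    rintro y (rfl | hy)
    · exact hbt
    · exact hs.2.2 y hy
  · rintro s ⟨y, hy⟩ ⟨hs, -, -⟩
    obtain ⟨x, hxX, hx⟩ := hchain s ⟨y, hy⟩ hs
    refine ⟨x, fun t ht => ?_⟩
    have hcomp : ∀ z ∈ s, ∀ t' ∈ insert x t, t' ≤ z ∨ z ≤ t' := by
      rintro z hz t' (rfl | ht')
      · exact hx z hz
      · exact ht.2.2 z hz t' ht'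
    have hsub : insert x t ⊆ X := Set.insert_subset hxX ht.2.1.1
    refine ⟨hs, ⟨hsub, ?_⟩, hcomp⟩
    -- An antichain comparable with `y` lies on one side of `y`, so adding `x` keeps the set
    -- bounded.
    exact ((hX.subset hsub).subset_Iic_or_subset_Ici (hcomp y hy)).imp
      (fun h => ⟨y, fun z hz => h hz⟩) (fun h => ⟨y, fun z hz => h hz⟩)
  · intro s
    exact ⟨fun hs => ⟨hs, ⟨Set.empty_subset _, Or.inl bddAbove_empty⟩, by simp⟩, fun hs => hs.1⟩
  · intro t
    exact ⟨fun ht => ⟨IsChain.empty, ht, by simp⟩, fun ht => ht.2.1⟩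

end Poset

/-! ### Homology of a disjoint union of acyclic pieces -/

/-- The linear map that is inverse to `single a ↦ single (f a)` on the range of `f` and kills the
other basis elements. -/
def restrictChains {α : Type u} {β : Type v} (f : α → β) : (β →₀ ℤ) →ₗ[ℤ] (α →₀ ℤ) := by
  classical
  exact Finsupp.linearCombination ℤ fun b =>
    if h : ∃ a, f a = b then Finsupp.single h.choose 1 else 0

theorem restrictChains_single {α : Type u} {β : Type v} {f : α → β} (hf : Function.Injective f)
    (a : α) (c : ℤ) : restrictChains f (Finsupp.single (f a) c) = Finsupp.single a c := by
  have h : ∃ a', f a' = f a := ⟨a, rfl⟩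
  have ha : h.choose = a := hf h.choose_spec
  simp [restrictChains, ha]

theorem restrictChains_single_of_notMem {α : Type u} {β : Type v} {f : α → β} {b : β}
    (hb : ∀ a, f a ≠ b) (c : ℤ) : restrictChains f (Finsupp.single b c) = 0 := by
  simp [restrictChains, hb]

namespace AugSemisimplicialSet

variable {T : AugSemisimplicialSet.{u}} {m : ℕ} {T' : Fin m → AugSemisimplicialSet.{v}}

/-- The simplices of positive size of `T` are the disjoint union of those of the `T' i`. -/
structure IsDisjointUnion (f : ∀ i k, (T' i).obj k → T.obj k) : Prop where
  facet_comm : ∀ i k (j : Fin (k + 1)) v, f i k ((T' i).facet j v) = T.facet j (f i (k + 1) v)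
  injective : ∀ i k, Function.Injective (f i k)
  cover : ∀ k (v : T.obj (k + 1)), ∃ i u, f i (k + 1) u = v
  disjoint : ∀ i j k u v, f i (k + 1) u = f j (k + 1) v → i = j

namespace IsDisjointUnion

variable {f : ∀ i k, (T' i).obj k → T.obj k} (hf : IsDisjointUnion f)
include hf

theorem restrictChains_single_ne {i j : Fin m} (hij : i ≠ j) (k : ℕ) (u : (T' j).obj (k + 1))
    (c : ℤ) : restrictChains (f i (k + 1)) (Finsupp.single (f j (k + 1) u) c) = 0 :=
  restrictChains_single_of_notMem (fun _ h => hij (hf.disjoint _ _ _ _ _ h)) c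

/-- A simplex with at least two vertices lies in the same piece as its facets. With one vertex this
breaks down, since the empty facet is not assigned to a single piece. -/
theorem boundary_restrictChains (i : Fin m) (k : ℕ) (z : T.obj (k + 2) →₀ ℤ) :
    (T' i).boundary (k + 1) (restrictChains (f i (k + 2)) z) =
      restrictChains (f i (k + 1)) (T.boundary (k + 1) z) := by
  suffices h : (T' i).boundary (k + 1) ∘ₗ restrictChains (f i (k + 2)) =
      restrictChains (f i (k + 1)) ∘ₗ T.boundary (k + 1) from LinearMap.congr_fun h z
  refine Finsupp.lhom_ext fun v c => ?_
  obtain ⟨j, u, rfl⟩ := hf.cover _ v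
  simp only [LinearMap.comp_apply, boundary_single, map_sum, map_smul, ← hf.facet_comm]
  by_cases hij : i = j
  · subst hij
    simp only [restrictChains_single (hf.injective i _), boundary_single]
  · simp only [hf.restrictChains_single_ne hij, map_zero, smul_zero, Finset.sum_const_zero]

theorem sum_mapDomain_restrictChains (k : ℕ) (z : T.obj (k + 1) →₀ ℤ) :
    ∑ i, Finsupp.lmapDomain ℤ ℤ (f i (k + 1)) (restrictChains (f i (k + 1)) z) = z := by
  suffices h : ∑ i, Finsupp.lmapDomain ℤ ℤ (f i (k + 1)) ∘ₗ restrictChains (f i (k + 1)) =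
      LinearMap.id by
    simpa using LinearMap.congr_fun h z
  refine Finsupp.lhom_ext fun v c => ?_
  obtain ⟨j, u, rfl⟩ := hf.cover _ v
  simp only [LinearMap.sum_apply, LinearMap.comp_apply, LinearMap.id_apply]
  rw [Finset.sum_eq_single j]
  · simp [restrictChains_single (hf.injective j _)]
  · intro i _ hij
    rw [hf.restrictChains_single_ne hij, map_zero]
  · simp

theorem mem_range_boundary (k : ℕ) (z : T.obj (k + 1) →₀ ℤ)
    (h : ∀ i, ∃ y, (T' i).boundary (k + 1) y = restrictChains (f i (k + 1)) z) :
    ∃ y, T.boundary (k + 1) y = z := by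
  choose y hy using h
  refine ⟨∑ i, Finsupp.lmapDomain ℤ ℤ (f i (k + 2)) (y i), ?_⟩
  rw [map_sum, ← hf.sum_mapDomain_restrictChains k z]
  refine Finset.sum_congr rfl fun i _ => ?_
  rw [boundary_mapDomain (f i) (hf.facet_comm i) (k + 1), hy]

theorem exact_of_acyclic (hT' : ∀ i, (T' i).Acyclic) (k : ℕ) (z : T.obj (k + 2) →₀ ℤ)
    (hz : T.boundary (k + 1) z = 0) : ∃ y, T.boundary (k + 2) y = z :=
  hf.mem_range_boundary _ z fun i => (hT' i).2 _ _ (by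
    rw [hf.boundary_restrictChains, hz, map_zero])

/-- The map `φ` adds up the coefficients over each piece. Cycles are the chains whose `φ` has total
sum zero, and boundaries are those with `φ = 0`, so the homology is the sum-zero part of `ℤ^m`;
dropping one coordinate identifies it with `ℤ^(m-1)`. -/
theorem nonempty_homology_zero_equiv [Unique (T.obj 0)] [∀ i, Unique ((T' i).obj 0)]
    (hm : m ≠ 0) (hT' : ∀ i, (T' i).Acyclic) :
    Nonempty ((LinearMap.ker (T.boundary 0) ⧸
      (LinearMap.range (T.boundary 1)).submoduleOf (LinearMap.ker (T.boundary 0))) ≃+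
        (Fin (m - 1) → ℤ)) := by
  obtain ⟨m, rfl⟩ := Nat.exists_eq_succ_of_ne_zero hm
  have hcov := hf.cover
  choose cl u hu using hcov
  have hcl (k i) (x : (T' i).obj (k + 1)) : cl k (f i (k + 1) x) = i :=
    hf.disjoint _ _ _ _ _ (hu k _)
  let φ : (T.obj 1 →₀ ℤ) →ₗ[ℤ] (Fin (m + 1) →₀ ℤ) := Finsupp.lmapDomain ℤ ℤ (cl 0)
  have hφ (v : T.obj 1) (c : ℤ) : φ (Finsupp.single v c) = Finsupp.single (cl 0 v) c := by
    simp [φ]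
  have hbdry (z : T.obj 1 →₀ ℤ) : T.boundary 0 z = Finsupp.single default (∑ i, φ z i) := by
    induction z using Finsupp.induction_linear with
    | zero => simp
    | add x y hx hy => simp [hx, hy, Finset.sum_add_distrib]
    | single v c =>
      rw [hφ, boundary_single]
      simp [Finsupp.single_apply]
  have hbdry' (i) (z : T.obj 1 →₀ ℤ) : (T' i).boundary 0 (restrictChains (f i 1) z) =
      Finsupp.single default (φ z i) := by
    induction z using Finsupp.induction_linear with
    | zero => simp
    | add x y hx hy => simp [hx, hy]
    | single v c =>
      obtain ⟨j, x, rfl⟩ := hf.cover _ v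
      rw [hφ, hcl]
      by_cases hij : i = j
      · subst hij
        rw [restrictChains_single (hf.injective i _), boundary_single]
        simp
      · rw [hf.restrictChains_single_ne hij]
        simp [Ne.symm hij]
  have hφb (z) : φ (T.boundary 1 z) = 0 := by
    induction z using Finsupp.induction_linear with
    | zero => simp
    | add x y hx hy => simp [hx, hy]
    | single v c =>
      obtain ⟨j, x, rfl⟩ := hf.cover _ v
      rw [boundary_single, Fin.sum_univ_two, map_add, map_smul, map_smul, ← hf.facet_comm,
        ← hf.facet_comm, hφ, hφ, hcl, hcl]
      simp
  -- Exactness at the augmentation forces each piece to have a vertex.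
  have hvert (i) : Nonempty ((T' i).obj 1) := by
    by_contra hne
    obtain ⟨y, hy⟩ := (hT' i).1 (Finsupp.single default 1)
    have : y = 0 := by
      ext v
      exact (hne ⟨v⟩).elim
    rw [this, map_zero] at hy
    exact absurd hy.symm (by simp)
  have x (i) := (hvert i).some
  let ψ : LinearMap.ker (T.boundary 0) →ₗ[ℤ] (Fin m → ℤ) :=
    (LinearMap.pi fun j => Finsupp.lapply j.succ ∘ₗ φ) ∘ₗ (LinearMap.ker (T.boundary 0)).subtype
  have hψ (z j) : ψ z j = φ z j.succ := rfl
  have hsurj : Function.Surjective ψ := by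
    intro a
    have hφa : φ (∑ j, (Finsupp.single (f _ 1 (x (Fin.succ j))) (a j) -
        Finsupp.single (f _ 1 (x 0)) (a j))) =
        ∑ j, (Finsupp.single (Fin.succ j) (a j) - Finsupp.single 0 (a j)) := by
      simp only [map_sum, map_sub, hφ, hcl]
    refine ⟨⟨∑ j, (Finsupp.single (f _ 1 (x (Fin.succ j))) (a j) -
      Finsupp.single (f _ 1 (x 0)) (a j)), ?_⟩, ?_⟩
    · rw [LinearMap.mem_ker, map_sum]
      refine Finset.sum_eq_zero fun j _ => ?_
      rw [map_sub, hbdry, hbdry, hφ, hφ]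
      simp [Finsupp.single_apply]
    · funext j
      rw [hψ, hφa]
      simp [Finsupp.single_apply]
  have hker : (LinearMap.range (T.boundary 1)).submoduleOf (LinearMap.ker (T.boundary 0)) =
      LinearMap.ker ψ := by
    ext z
    rw [LinearMap.mem_ker]
    constructor
    · rintro ⟨y, hy⟩
      funext j
      rw [hψ, ← Submodule.subtype_apply, ← hy, hφb]
      rfl
    · intro hz
      have hsucc (j : Fin m) : φ z j.succ = 0 := by rw [← hψ, hz, Pi.zero_apply]
      have hsum : ∑ i, φ z i = 0 := by
        have := hbdry z
        rw [LinearMap.mem_ker.1 z.2] at this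
        simpa using this.symm
      have hzero (i) : φ z i = 0 := by
        refine Fin.cases ?_ hsucc i
        simpa [Fin.sum_univ_succ, hsucc] using hsum
      obtain ⟨y, hy⟩ := hf.mem_range_boundary 0 z fun i => (hT' i).2 0 _ (by
        rw [hbdry', hzero, Finsupp.single_zero])
      exact ⟨y, hy⟩
  exact ⟨((Submodule.quotEquivOfEq _ _ hker).trans
    (ψ.quotKerEquivOfSurjective hsurj)).toAddEquiv⟩

end IsDisjointUnion

end AugSemisimplicialSet

/-- The ordered simplices of a complex, with the empty tuple as augmentation. -/
def PreAbstractSimplicialComplex.toAugSemisimplicialSet {V : Type u}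
    (K : PreAbstractSimplicialComplex V) : AugSemisimplicialSet.{u} where
  obj := K.OrderedSimplex
  facet := OrderedSimplex.facet
  facet_facet := OrderedSimplex.facet_facet K

/-! ### The component of a family below a class of its members -/

/-- The nonempty members of `G` that are contained in a member of `c`. -/
abbrev Component (G c : Set (Set ℕ)) : Type :=
  {A : G // A.1.Nonempty ∧ ∃ S ∈ c, A.1 ⊆ S}

namespace Component

variable {G c : Set (Set ℕ)}

/-- The inclusion of a component into the family with a top element adjoined. -/
def toWithTop (p : Component G c) : WithTop G := ((p.1 : G) : WithTop G)

theorem toWithTop_le {p q : Component G c} : p.toWithTop ≤ q.toWithTop ↔ p ≤ q :=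
  WithTop.coe_le_coe

theorem toWithTop_injective : Function.Injective (toWithTop (G := G) (c := c)) := fun _ _ h =>
  le_antisymm (toWithTop_le.1 h.le) (toWithTop_le.1 h.ge)

theorem exists_isLUB (hG : IsLowerSet G) {t : Set (Component G c)} (ht : t.Nonempty)
    (hb : BddAbove t) : ∃ b, IsLUB t b := by
  obtain ⟨B, hB⟩ := hb
  have hsub : (⋃ p ∈ t, p.1.1) ⊆ B.1.1 := Set.iUnion₂_subset fun p hp => hB hp
  obtain ⟨q, hq⟩ := ht
  obtain ⟨S, hS, hBS⟩ := B.2.2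
  refine ⟨⟨⟨⋃ p ∈ t, p.1.1, hG hsub B.1.2⟩, ?_, S, hS, hsub.trans hBS⟩, ?_, ?_⟩
  · obtain ⟨x, hx⟩ := q.2.1
    exact ⟨x, Set.mem_biUnion hq hx⟩
  · intro p hp
    exact Set.subset_biUnion_of_mem (u := fun p : Component G c => p.1.1) hp
  · intro r hr
    exact Set.iUnion₂_subset fun p hp => hr hp

/-- The meet is the intersection; a lower bound inside the component is a nonempty set, which keeps
the intersection nonempty. -/
theorem exists_isGLB (hG : IsLowerSet G) {t : Set (Component G c)} (ht : t.Nonempty)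
    (hb : BddBelow t) : ∃ b, IsGLB t b := by
  obtain ⟨B, hB⟩ := hb
  obtain ⟨q, hq⟩ := ht
  have hsub : (⋂ p ∈ t, p.1.1) ⊆ q.1.1 := Set.biInter_subset_of_mem hq
  obtain ⟨S, hS, hqS⟩ := q.2.2
  refine ⟨⟨⟨⋂ p ∈ t, p.1.1, hG hsub q.1.2⟩, ?_, S, hS, hsub.trans hqS⟩, ?_, ?_⟩
  · obtain ⟨x, hx⟩ := B.2.1
    exact ⟨x, Set.mem_iInter₂.2 fun p hp => hB hp hx⟩
  · intro p hp
    exact Set.biInter_subset_of_mem (t := fun p : Component G c => p.1.1) hp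
  · intro r hr
    exact Set.subset_iInter₂ fun p hp => hr hp

/-- Take `M` to be the members of `c`. For a common element `a`, the singleton `{a}` bounds them
below, and the largest element of a finite chain lies under one of them. -/
theorem acyclic_orderComplex_of_sInter_nonempty (hG : IsLowerSet G) (hfin : G.Finite)
    (hcG : c ⊆ G) (hc : c.Nonempty) (hne : (⋂₀ c).Nonempty) :
    (orderComplex (Component G c)).tuples.Acyclic := by
  obtain ⟨a, ha⟩ := hne
  have hmem (S) (hS : S ∈ c) : ∃ p : Component G c, p.1.1 = S :=
    ⟨⟨⟨S, hcG hS⟩, ⟨a, ha S hS⟩, S, hS, subset_rfl⟩, rfl⟩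
  have : Finite G := hfin
  obtain ⟨S, hS⟩ := hc
  refine acyclic_orderComplex (M := {p | p.1.1 ∈ c}) ?_ ?_ (fun t => exists_isGLB hG) ?_
  · obtain ⟨p, hp⟩ := hmem S hS
    exact ⟨p, show p.1.1 ∈ c from hp ▸ hS⟩
  · have hsub : {a} ⊆ S := Set.singleton_subset_iff.2 (ha S hS)
    refine ⟨⟨⟨{a}, hG hsub (hcG hS)⟩, Set.singleton_nonempty a, S, hS, hsub⟩, ?_⟩
    intro p hp
    exact Set.singleton_subset_iff.2 (ha _ hp)
  · intro s hs hchain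
    obtain ⟨q, hq⟩ := (Set.toFinite s).exists_maximal hs
    obtain ⟨S', hS', hqS'⟩ := q.2.2
    obtain ⟨p, hp⟩ := hmem S' hS'
    refine ⟨p, show p.1.1 ∈ c from hp ▸ hS', fun r hr => ?_⟩
    have hrq : r ≤ q := (hchain.total hr hq.1).elim id fun h => hq.2 hr h
    have : q ≤ p := show q.1.1 ⊆ p.1.1 by rwa [hp]
    exact hrq.trans this

theorem not_isSpanning_image (hG : ∅ ∈ G) {t : Set (Component G c)}
    (hb : BddAbove t ∨ BddBelow t) : ¬ IsSpanning (toWithTop '' t) := by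
  rintro ⟨⟨x, hx, hlub⟩, y, hy, hglb⟩
  rcases hb with ⟨p, hp⟩ | ⟨p, hp⟩
  · have hxp : x ≤ p.toWithTop := hlub.2 (by
      rintro _ ⟨q, hq, rfl⟩
      exact toWithTop_le.2 (hp hq))
    exact WithTop.coe_ne_top (top_le_iff.1 ((hx ⊤).trans hxp))
  · have hpy : p.toWithTop ≤ y := hglb.2 (by
      rintro _ ⟨q, hq, rfl⟩
      exact toWithTop_le.2 (hp hq))
    have hle : p.toWithTop ≤ ((⟨∅, hG⟩ : G) : WithTop G) := hpy.trans (hy _)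
    obtain ⟨z, hz⟩ := p.2.1
    exact (WithTop.coe_le_coe.1 hle) hz

end Component

/-! ### Cross-cuts of a family whose maximal members split into classes -/

section Classes

variable {G : Set (Set ℕ)} {m : ℕ} {c : Fin m → Set (Set ℕ)} {C : Set (WithTop G)}

theorem coe_le_coe_iff_subset {A B : G} : (A : WithTop G) ≤ B ↔ A.1 ⊆ B.1 :=
  WithTop.coe_le_coe

theorem eq_of_subset_of_subset (hdisj : ∀ i j, i ≠ j → ∀ S ∈ c i, ∀ T ∈ c j, S ∩ T = ∅)
    {i j : Fin m} {A S T : Set ℕ} (hA : A.Nonempty) (hS : S ∈ c i) (hT : T ∈ c j) (hAS : A ⊆ S)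
    (hAT : A ⊆ T) : i = j := by
  by_contra hij
  obtain ⟨x, hx⟩ := hA
  have : x ∈ S ∩ T := ⟨hAS hx, hAT hx⟩
  rw [hdisj i j hij S hS T hT] at this
  exact this

/-- The part of a cross-cut that lies in a component. -/
def componentPart (C : Set (WithTop G)) (c : Set (Set ℕ)) : Set (Component G c) :=
  {p | p.toWithTop ∈ C}

theorem IsCrossCut.exists_coe (hC : IsCrossCut C) {x : WithTop G}
    (hx : x ∈ C) : ∃ A : G, A.1.Nonempty ∧ x = A := by
  induction x with
  | top => exact absurd isTop_top (hC.not_isTop _ hx)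
  | coe A =>
    refine ⟨A, ?_, rfl⟩
    by_contra hA
    refine hC.not_isBot _ hx fun y => ?_
    induction y with
    | top => exact le_top
    | coe B =>
      refine WithTop.coe_le_coe.2 ?_
      change A.1 ⊆ B.1
      rw [Set.not_nonempty_iff_eq_empty.1 hA]
      exact Set.empty_subset _

theorem IsCrossCut.isAntichain_componentPart (hC : IsCrossCut C) (c : Set (Set ℕ)) :
    IsAntichain (· ≤ ·) (componentPart C c) := fun _ hp _ hq hpq hle =>
  hC.isAntichain hp hq (Component.toWithTop_injective.ne hpq) (Component.toWithTop_le.2 hle)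

/-- Extend the chain to a maximal chain of the whole lattice and take a point of `C` on it. This
point is a nonempty set comparable with an element of the component, hence in the same component. -/
theorem IsCrossCut.exists_comparable (hC : IsCrossCut C)
    (hdisj : ∀ i j, i ≠ j → ∀ S ∈ c i, ∀ T ∈ c j, S ∩ T = ∅)
    (hcover : ∀ A ∈ G, ∃ i, ∃ S ∈ c i, A ⊆ S) (i : Fin m) {s : Set (Component G (c i))}
    (hs : s.Nonempty) (hchain : IsChain (· ≤ ·) s) :
    ∃ x ∈ componentPart C (c i), ∀ y ∈ s, x ≤ y ∨ y ≤ x := by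
  have himage : IsChain (· ≤ ·) (Component.toWithTop '' s) := by
    rintro _ ⟨p, hp, rfl⟩ _ ⟨q, hq, rfl⟩ -
    exact (hchain.total hp hq).imp Component.toWithTop_le.2 Component.toWithTop_le.2
  obtain ⟨M, hM, hsM⟩ := himage.exists_maxChain
  obtain ⟨x, hxM, hxC⟩ := hC.meets_maxChain M hM
  obtain ⟨A, hA, rfl⟩ := hC.exists_coe hxC
  have hcomp (p) (hp : p ∈ s) : (A : WithTop G) ≤ p.toWithTop ∨ p.toWithTop ≤ A :=
    hM.isChain.total hxM (hsM ⟨p, hp, rfl⟩)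
  obtain ⟨p, hp⟩ := hs
  obtain ⟨S, hS, hpS⟩ := p.2.2
  have hAc : ∃ S ∈ c i, A.1 ⊆ S := by
    rcases hcomp p hp with h | h
    · exact ⟨S, hS, subset_trans (coe_le_coe_iff_subset.1 h) hpS⟩
    · obtain ⟨j, T, hT, hAT⟩ := hcover A.1 A.2
      have hpA : p.1.1 ⊆ A.1 := coe_le_coe_iff_subset.1 h
      obtain rfl := eq_of_subset_of_subset hdisj p.2.1 hS hT hpS (hpA.trans hAT)
      exact ⟨T, hT, hAT⟩
  exact ⟨⟨A, hA, hAc⟩, hxC, fun q hq =>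
    (hcomp q hq).imp (Component.toWithTop_le (p := ⟨A, hA, hAc⟩)).1
      (Component.toWithTop_le (q := ⟨A, hA, hAc⟩)).1⟩

/-- A nonempty face of the cross-cut complex lies in a single component and is bounded there. -/
theorem IsCrossCut.exists_component_of_not_isSpanning (hC : IsCrossCut C) (hG : ∅ ∈ G)
    (hdisj : ∀ i j, i ≠ j → ∀ S ∈ c i, ∀ T ∈ c j, S ∩ T = ∅)
    (hcover : ∀ A ∈ G, ∃ i, ∃ S ∈ c i, A ⊆ S) {s : Set (WithTop G)} (hs : s.Nonempty)
    (hsC : s ⊆ C) (hspan : ¬ IsSpanning s) :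
    ∃ i, ∃ t : Set (Component G (c i)), Component.toWithTop '' t = s ∧
      (BddAbove t ∨ BddBelow t) := by
  have hlift (i : Fin m) (h : ∀ A : G, (A : WithTop G) ∈ s → ∃ S ∈ c i, A.1 ⊆ S) :
      Component.toWithTop '' {p : Component G (c i) | p.toWithTop ∈ s} = s := by
    refine Set.Subset.antisymm (Set.image_subset_iff.2 fun _ hp => hp) fun x hx => ?_
    obtain ⟨A, hA, rfl⟩ := hC.exists_coe (hsC hx)
    exact ⟨⟨A, hA, h A hx⟩, hx, rfl⟩
  obtain ⟨x, hx⟩ := hs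
  obtain ⟨X, hXne, rfl⟩ := hC.exists_coe (hsC hx)
  by_cases hup : ∃ B : G, ∀ y ∈ s, y ≤ B
  · obtain ⟨B, hB⟩ := hup
    obtain ⟨i, S, hS, hBS⟩ := hcover B.1 B.2
    refine ⟨i, _, hlift i fun A hA => ⟨S, hS, subset_trans (coe_le_coe_iff_subset.1 (hB _ hA)) hBS⟩,
      Or.inl ⟨⟨B, hXne.mono (coe_le_coe_iff_subset.1 (hB _ hx)), S, hS, hBS⟩, fun p hp => ?_⟩⟩
    exact coe_le_coe_iff_subset.1 (hB _ hp)
  by_cases hdown : ∃ B : G, B.1.Nonempty ∧ ∀ y ∈ s, (B : WithTop G) ≤ y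
  · obtain ⟨B, hBne, hB⟩ := hdown
    obtain ⟨i, S, hS, hBS⟩ := hcover B.1 B.2
    refine ⟨i, _, hlift i fun A hA => ?_, Or.inr ⟨⟨B, hBne, S, hS, hBS⟩, fun p hp => ?_⟩⟩
    · obtain ⟨j, T, hT, hAT⟩ := hcover A.1 A.2
      have hBA : B.1 ⊆ A.1 := coe_le_coe_iff_subset.1 (hB _ hA)
      obtain rfl := eq_of_subset_of_subset hdisj hBne hS hT hBS (hBA.trans hAT)
      exact ⟨T, hT, hAT⟩
    · exact coe_le_coe_iff_subset.1 (hB _ hp)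
  -- With no bound of either kind the join is `⊤` and the meet is `∅`, so `s` would span.
  push Not at hup hdown
  refine absurd ⟨⟨⊤, isTop_top, fun _ _ => le_top, fun y hy => ?_⟩,
    ((⟨∅, hG⟩ : G) : WithTop G), ?_, ?_, fun y hy => ?_⟩ hspan
  · induction y with
    | top => exact le_rfl
    | coe B =>
      obtain ⟨z, hz, hzB⟩ := hup B
      exact absurd (hy hz) hzB
  · intro y
    induction y with
    | top => exact le_top
    | coe B => exact WithTop.coe_le_coe.2 (Set.empty_subset B.1)
  · intro y hy
    obtain ⟨B, -, rfl⟩ := hC.exists_coe (hsC hy)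
    exact WithTop.coe_le_coe.2 (Set.empty_subset B.1)
  · induction y with
    | top => exact absurd (hy hx) (WithTop.not_top_le_coe X)
    | coe B =>
      refine WithTop.coe_le_coe.2 ?_
      change B.1 ⊆ ∅
      by_contra hB
      obtain ⟨z, hz, hBz⟩ := hdown B (Set.nonempty_iff_ne_empty.2 fun h => hB h.subset)
      exact hBz (hy hz)

/-- The inclusion of a component of the cross-cut complex, on ordered simplices. -/
def componentInclusion (hG : ∅ ∈ G) (C : Set (WithTop G)) (d : Set (Set ℕ)) (k : ℕ)
    (v : (boundedComplex (componentPart C d)).tuples.obj k) :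
    (crossCutComplex C).toAugSemisimplicialSet.obj k :=
  ⟨fun j => (v.1 j).toWithTop, by
    classical
    rcases Nat.eq_zero_or_pos k with hk | hk
    · exact Or.inl hk
    have hne : (Set.range v.1).Nonempty := ⟨_, ⟨0, hk⟩, rfl⟩
    have himage : ((Finset.univ.image fun j => (v.1 j).toWithTop : Finset (WithTop G)) :
        Set (WithTop G)) = Component.toWithTop '' Set.range v.1 := by
      rw [← Set.range_comp]
      simp [Function.comp_def]
    refine Or.inr ⟨Finset.univ.image fun j => (v.1 j).toWithTop, ⟨?_, ?_, ?_⟩, by simp⟩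
    · rw [← Finset.coe_nonempty, himage]
      exact hne.image _
    · rw [himage]
      exact Set.image_subset_iff.2 v.2.1
    · rw [himage]
      exact Component.not_isSpanning_image hG v.2.2⟩

theorem IsCrossCut.isDisjointUnion (hC : IsCrossCut C) (hG : ∅ ∈ G)
    (hdisj : ∀ i j, i ≠ j → ∀ S ∈ c i, ∀ T ∈ c j, S ∩ T = ∅)
    (hcover : ∀ A ∈ G, ∃ i, ∃ S ∈ c i, A ⊆ S) :
    AugSemisimplicialSet.IsDisjointUnion fun i => componentInclusion hG C (c i) where
  facet_comm i k j v := rfl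
  injective i k v w h := Subtype.ext (funext fun j =>
    Component.toWithTop_injective (congrFun (congrArg Subtype.val h) j))
  cover k v := by
    obtain h | ⟨s, ⟨hs, hsC, hspan⟩, hsv⟩ := v.2
    · omega
    obtain ⟨i, t, hts, ht⟩ := hC.exists_component_of_not_isSpanning hG hdisj hcover
      (Finset.coe_nonempty.2 hs) hsC hspan
    have hmem (j) : ∃ p ∈ t, p.toWithTop = v.1 j := by
      have : v.1 j ∈ Component.toWithTop '' t := by
        rw [hts, hsv]
        exact Set.mem_range_self j
      exact this
    choose p hpt hp using hmem
    have hrange : Set.range p ⊆ t := Set.range_subset_iff.2 hpt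
    refine ⟨i, ⟨p, Set.range_subset_iff.2 fun j => ?_, ?_⟩, Subtype.ext (funext hp)⟩
    · change (p j).toWithTop ∈ C
      refine hsC ?_
      rw [hp, hsv]
      exact Set.mem_range_self j
    · exact ht.imp (·.mono hrange) (·.mono hrange)
  disjoint i j k u v h := by
    have h0 : (u.1 0).toWithTop = (v.1 0).toWithTop := congrFun (congrArg Subtype.val h) 0
    have h1 : (u.1 0).1 = (v.1 0).1 := WithTop.coe_injective h0
    obtain ⟨S, hS, huS⟩ := (u.1 0).2.2
    obtain ⟨T, hT, hvT⟩ := (v.1 0).2.2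
    exact eq_of_subset_of_subset hdisj (u.1 0).2.1 hS hT huS (h1 ▸ hvT)

theorem IsCrossCut.acyclic_component (hC : IsCrossCut C) (hG : IsLowerSet G) (hfin : G.Finite)
    (hdisj : ∀ i j, i ≠ j → ∀ S ∈ c i, ∀ T ∈ c j, S ∩ T = ∅)
    (hcover : ∀ A ∈ G, ∃ i, ∃ S ∈ c i, A ⊆ S) (i : Fin m) (hcG : c i ⊆ G)
    (hne : (c i).Nonempty) (hinter : (⋂₀ c i).Nonempty) :
    (boundedComplex (componentPart C (c i))).tuples.Acyclic :=
  acyclic_boundedComplex (hC.isAntichain_componentPart _)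
    (fun _ => Component.exists_isLUB hG) (fun _ => Component.exists_isGLB hG)
    (fun _ => hC.exists_comparable hdisj hcover i)
    (Component.acyclic_orderComplex_of_sInter_nonempty hG hfin hcG hne hinter)

theorem IsCrossCut.reducedHomology (hC : IsCrossCut C) (hG : IsLowerSet G) (hfin : G.Finite)
    (hm : m ≠ 0) (hdisj : ∀ i j, i ≠ j → ∀ S ∈ c i, ∀ T ∈ c j, S ∩ T = ∅)
    (hcover : ∀ A ∈ G, ∃ i, ∃ S ∈ c i, A ⊆ S) (hcG : ∀ i, c i ⊆ G)
    (hne : ∀ i, (c i).Nonempty) (hinter : ∀ i, (⋂₀ c i).Nonempty) :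
    Nonempty ((crossCutComplex C).reducedHomology 0 ≃+ (Fin (m - 1) → ℤ)) ∧
      ∀ k : ℕ, 0 < k → Subsingleton ((crossCutComplex C).reducedHomology k) := by
  have hempty : ∅ ∈ G := by
    obtain ⟨S, hS⟩ := hne ⟨0, Nat.pos_of_ne_zero hm⟩
    exact hG (Set.empty_subset S) (hcG _ hS)
  have hU := hC.isDisjointUnion hempty hdisj hcover
  have hacyc (i) := hC.acyclic_component hG hfin hdisj hcover i (hcG i) (hne i) (hinter i)
  refine ⟨?_, fun k hk => ?_⟩
  · let _ : Unique ((crossCutComplex C).toAugSemisimplicialSet.obj 0) :=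
      { default := ⟨Fin.elim0, Or.inl rfl⟩
        uniq v := Subtype.ext (Subsingleton.elim _ _) }
    -- For the empty tuple to count, the component must contain some bound; any member of `c i`
    -- serves.
    let _ (i) : Unique ((boundedComplex (componentPart C (c i))).tuples.obj 0) :=
      { default := ⟨Fin.elim0, by
          rw [Set.range_eq_empty]
          exact ⟨Set.empty_subset _, Or.inr
            ((hne i).elim fun S hS => ⟨⟨⟨S, hcG i hS⟩,
              (hinter i).mono (Set.sInter_subset_of_mem hS), S, hS, subset_rfl⟩, by simp⟩)⟩⟩
        uniq v := Subtype.ext (Subsingleton.elim _ _) }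
    exact hU.nonempty_homology_zero_equiv hm hacyc
  · obtain ⟨k, rfl⟩ := Nat.exists_eq_succ_of_ne_zero hk.ne'
    refine Submodule.Quotient.subsingleton_iff.2 (eq_top_iff.2 fun z _ => ?_)
    obtain ⟨y, hy⟩ := hU.exact_of_acyclic hacyc k z.1 (LinearMap.mem_ker.1 z.2)
    exact ⟨y, hy⟩

end Classes

/-! ### Application to `familyRestrict F n` -/

theorem isLowerSet_familyRestrict {F : Set (Set ℕ)} (hF : IsLowerSet F) (n : ℕ) :
    IsLowerSet (familyRestrict F n) := fun _ _ hle hS => ⟨hF hle hS.1, hle.trans hS.2⟩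

theorem finite_familyRestrict (F : Set (Set ℕ)) (n : ℕ) : (familyRestrict F n).Finite :=
  (Set.finite_Icc 1 n).finite_subsets.subset fun _ hS => hS.2

theorem lemma1 (F : Set (Set ℕ)) (m : ℕ)
    (hF : IsLowerSet F)
    (hpart : IsPartitionIntersecting F m)
    (htop : ∀ n : ℕ, 2 ≤ n → Set.Icc 1 n ∉ familyRestrict F n)
    (n : ℕ) (hn : 2 ≤ n)
    (C : Set (familyLattice F n)) (hC : IsCrossCut C) :
    Nonempty ((crossCutComplex C).reducedHomology 0 ≃+ (Fin (m - 1) → ℤ)) ∧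
      ∀ k : ℕ, 0 < k → Subsingleton ((crossCutComplex C).reducedHomology k) := by
  obtain ⟨c, hne, -, hunion, hinter, hdisj⟩ := hpart n hn
  have hmem (S) : (∃ i, S ∈ c i) ↔ Maximal (· ∈ familyRestrict F n) S := by
    rw [← Set.mem_iUnion, hunion, Set.mem_ofPred_eq]
  have hcover : ∀ A ∈ familyRestrict F n, ∃ i, ∃ S ∈ c i, A ⊆ S := by
    intro A hA
    obtain ⟨S, hAS, hS⟩ := (finite_familyRestrict F n).exists_le_maximal hA
    obtain ⟨i, hi⟩ := (hmem S).2 hS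
    exact ⟨i, S, hi, hAS⟩
  -- A point of the cross-cut is a member of the family, and it lies under a maximal one, so there
  -- is at least one class.
  have hm : m ≠ 0 := by
    rintro rfl
    obtain ⟨x, -, hx⟩ := hC.meets_maxChain _ maxChain_spec
    obtain ⟨A, -, -⟩ := hC.exists_coe hx
    obtain ⟨i, -⟩ := hcover A.1 A.2
    exact i.elim0
  exact hC.reducedHomology (isLowerSet_familyRestrict hF n) (finite_familyRestrict F n) hm hdisj
    hcover (fun i S hS => ((hmem S).1 ⟨i, hS⟩).prop) hne hinter

end
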